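/- Let $a,b\ge 1$ and $n\ge 0$ be integers. For a finite matroid $M$ on $E$ with rank function $\mathrm{rk}$, let $$T_M(x,y)=\sum_{A\subseteq E}(x-1)^{\mathrm{rk}(E)-\mathrm{rk}(A)}(y-1)^{|A|-\mathrm{rk}(A)}\in\mathbb Z[x,y]$$ be its Tutte polynomial. For $m\ge 0$ let $U_m^{a,b}$ be the uniform matroid of rank $mb$ on $[m(a+b)]$, and for a partition $\lambda=(\lambda_1,\dots,\lambda_k)$ of $n$ let $U_\lambda^{a,b}=U_{\lambda_1}^{a,b}\oplus\cdots\oplus U_{\lambda_k}^{a,b}$ and $z_\lambda=\prod_{i=1}^n i^{\alpha_i}\alpha_i!$, where $\alpha_i$ is the number of parts of $\lambda$ equal to $i$. Let $C_n^{a,b}$ be the $(a,b)$-Catalan matroid, i.e. the matroid on $[n(a+b)]$ whose bases are the sets $T\subseteq[n(a+b)]$ with $|T|=|S|$ such that, for each $i$, the $i$-th smallest element of $T$ is at most the $i$-th smallest element of $S$; here $S$ is the set with indicator vector $(0^a,1^b,0^a,1^b,\dots,0^a,1^b)$ ($n$ blocks $0^a,1^b$). Then $$T_{C_n^{a,b}}(x,y)=\sum_{\lambda\vdash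 n}\frac1{z_\lambda}\,T_{U_\lambda^{a,b}}(x,y)\quad\text{in }\mathbb Q[x,y],$$ where $T_{U_\lambda^{a,b}}(x,y)=\prod_{i=1}^k T_{U_{\lambda_i}^{a,b}}(x,y)$ for every partition $\lambda$ of $n$. -/

import Mathlib

open scoped BigOperators Nat

noncomputable section

namespace CatalanMatroid

/-- The Tutte polynomial of a finite matroid `M` on `E`, an element of `ℤ[x, y]` (`x = X 0`,
`y = X 1`): the sum of `(x - 1)^(rk E - rk A) (y - 1)^(|A| - rk A)` over all `A ⊆ E`.
The ranks are finite and `rk A ≤ rk E`, `rk A ≤ |A|`, so the exponents involve no truncation. -/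
def tutte {α : Type*} (M : Matroid α) [M.Finite] : MvPolynomial (Fin 2) ℤ :=
  ∑ A ∈ M.ground_finite.toFinset.powerset,
    (MvPolynomial.X 0 - 1) ^ ((M.eRk M.E).toNat - (M.eRk (A : Set α)).toNat) *
    (MvPolynomial.X 1 - 1) ^ (A.card - (M.eRk (A : Set α)).toNat)

/-- `T ≤ S`: the sets have the same size, and for every `i` the `i`-th smallest element of `T`
is less than or equal to the `i`-th smallest element of `S`. -/
def SubsetLE {m : ℕ} (T S : Finset (Fin m)) : Prop :=
  ∃ h : T.card = S.card, ∀ i : Fin S.card, T.orderEmbOfFin h i ≤ S.orderEmbOfFin rfl i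

/-- Counting form of `T ≤ S`, used to verify the exchange axiom. -/
theorem subsetLE_iff {m : ℕ} (T S : Finset (Fin m)) :
    SubsetLE T S ↔ T.card = S.card ∧
      ∀ j : Fin m, (S.filter (· ≤ j)).card ≤ (T.filter (· ≤ j)).card := by
  constructor
  · rintro ⟨h, hle⟩
    refine ⟨h, fun j => ?_⟩
    have hS : S.filter (· ≤ j) =
        (Finset.univ.filter fun i => S.orderEmbOfFin rfl i ≤ j).map
          (S.orderEmbOfFin rfl).toEmbedding := by
      conv_lhs => rw [← S.map_orderEmbOfFin_univ rfl]
      rw [Finset.filter_map]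
      rfl
    have hT : T.filter (· ≤ j) =
        (Finset.univ.filter fun i => T.orderEmbOfFin h i ≤ j).map
          (T.orderEmbOfFin h).toEmbedding := by
      conv_lhs => rw [← T.map_orderEmbOfFin_univ h]
      rw [Finset.filter_map]
      rfl
    rw [hS, hT, Finset.card_map, Finset.card_map]
    refine Finset.card_le_card fun i hi => ?_
    simp only [Finset.mem_filter, Finset.mem_univ, true_and] at hi ⊢
    exact (hle i).trans hi
  · rintro ⟨h, hle⟩
    refine ⟨h, fun i => ?_⟩
    by_contra! hlt
    have h1 : (Finset.Iic i).map (S.orderEmbOfFin rfl).toEmbedding ⊆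
        S.filter (· ≤ S.orderEmbOfFin rfl i) := by
      intro x hx
      simp only [Finset.mem_map, Finset.mem_Iic] at hx
      obtain ⟨k, hk, rfl⟩ := hx
      exact Finset.mem_filter.2 ⟨S.orderEmbOfFin_mem rfl k, (S.orderEmbOfFin rfl).monotone hk⟩
    have h2 : T.filter (· ≤ S.orderEmbOfFin rfl i) ⊆
        (Finset.Iio i).map (T.orderEmbOfFin h).toEmbedding := by
      intro x hx
      rw [Finset.mem_filter] at hx
      have hx1 : x ∈ Set.range (T.orderEmbOfFin h) := by
        rw [T.range_orderEmbOfFin h]; exact hx.1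
      obtain ⟨k, rfl⟩ := hx1
      refine Finset.mem_map.2 ⟨k, Finset.mem_Iio.2 ?_, rfl⟩
      exact (T.orderEmbOfFin h).lt_iff_lt.1 (hx.2.trans_lt hlt)
    have c1 := Finset.card_le_card h1
    have c2 := Finset.card_le_card h2
    have c3 := hle (S.orderEmbOfFin rfl i)
    rw [Finset.card_map, Fin.card_Iic] at c1
    rw [Finset.card_map, Fin.card_Iio] at c2
    omega

/-- Basis exchange for the sets `T ≤ S`. -/
theorem subsetLE_exchange {m : ℕ} {S T T' : Finset (Fin m)} (hT : SubsetLE T S)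
    (hT' : SubsetLE T' S) {e : Fin m} (he : e ∈ T) (he' : e ∉ T') :
    ∃ f ∈ T', f ∉ T ∧ SubsetLE (insert f (T.erase e)) S := by
  rw [subsetLE_iff] at hT hT'
  have hne : (T' \ T).Nonempty := by
    rw [Finset.sdiff_nonempty]
    intro hsub
    exact he' ((Finset.eq_of_subset_of_card_le hsub (by omega)) ▸ he)
  obtain ⟨f, hf⟩ : ∃ f, f = (T' \ T).min' hne := ⟨_, rfl⟩
  have hfm : f ∈ T' \ T := hf ▸ Finset.min'_mem _ _
  rw [Finset.mem_sdiff] at hfm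
  have hmin : ∀ g ∈ T', g ∉ T → f ≤ g := fun g h1 h2 =>
    hf ▸ Finset.min'_le _ _ (Finset.mem_sdiff.2 ⟨h1, h2⟩)
  have hfe : f ∉ T.erase e := fun h => hfm.2 (Finset.mem_of_mem_erase h)
  refine ⟨f, hfm.1, hfm.2, (subsetLE_iff _ _).2 ⟨?_, fun j => ?_⟩⟩
  · rw [Finset.card_insert_of_notMem hfe, Finset.card_erase_add_one he, hT.1]
  · by_cases hfj : f ≤ j
    · have h1 : (T.filter (· ≤ j)).card ≤ ((insert f (T.erase e)).filter (· ≤ j)).card := by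
        rw [Finset.filter_insert, if_pos hfj, Finset.card_insert_of_notMem
          (fun h => hfe (Finset.mem_of_mem_filter _ h)), Finset.filter_erase]
        have := Finset.pred_card_le_card_erase (s := T.filter (· ≤ j)) (a := e)
        omega
      exact (hT.2 j).trans h1
    · refine (hT'.2 j).trans (Finset.card_le_card fun g hg => ?_)
      rw [Finset.mem_filter] at hg ⊢
      have hgT : g ∈ T := by
        by_contra hgT
        exact hfj ((hmin g hg.1 hgT).trans hg.2)
      exact ⟨Finset.mem_insert_of_mem (Finset.mem_erase.2
        ⟨fun h => he' (h ▸ hg.1), hgT⟩), hg.2⟩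

/-- The Schubert matroid of `S`: the matroid on `Fin m = {0, …, m - 1}` whose bases are
the sets `T ≤ S`. -/
def schubert {m : ℕ} (S : Finset (Fin m)) : Matroid (Fin m) :=
  Matroid.ofIsBaseOfFinite (E := Set.univ) Set.finite_univ
    (fun B => ∃ T : Finset (Fin m), (T : Set (Fin m)) = B ∧ SubsetLE T S)
    ⟨S, S, rfl, rfl, fun _ => le_rfl⟩
    (by
      rintro _ _ ⟨T, rfl, hT⟩ ⟨T', rfl, hT'⟩ e ⟨he, he'⟩
      obtain ⟨f, hf, hf', h⟩ := subsetLE_exchange hT hT' he he'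
      exact ⟨f, ⟨hf, hf'⟩, _, by push_cast; rfl, h⟩)
    (fun _ _ => Set.subset_univ _)

/-- The `(a, b)`-Catalan matroid `C_n^{a,b}` on `n(a+b)` elements: the Schubert matroid of the set
whose indicator vector is `(0^a, 1^b, 0^a, 1^b, …, 0^a, 1^b)` (`n` blocks `0^a, 1^b`).
Positions are counted from `0`. -/
def catalan (a b n : ℕ) : Matroid (Fin (n * (a + b))) :=
  schubert (Finset.univ.filter fun i => a ≤ (i : ℕ) % (a + b))

/-- The uniform matroid `U_{k,m}` on `m` elements: the bases are all sets of size `k`. -/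
def uniform (k m : ℕ) (h : k ≤ m) : Matroid (Fin m) :=
  Matroid.ofIsBaseOfFinite (E := Set.univ) Set.finite_univ
    (fun B => ∃ T : Finset (Fin m), (T : Set (Fin m)) = B ∧ T.card = k)
    (by
      obtain ⟨T, -, hT⟩ := Finset.exists_subset_card_eq (s := (Finset.univ : Finset (Fin m)))
        (n := k) (by simpa using h)
      exact ⟨T, T, rfl, hT⟩)
    (by
      rintro _ _ ⟨T, rfl, hT⟩ ⟨T', rfl, hT'⟩ e ⟨he, he'⟩
      rw [Finset.mem_coe] at he he'
      obtain ⟨f, hf, hf'⟩ : ∃ f ∈ T', f ∉ T := by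
        by_contra! hsub
        exact he' ((Finset.eq_of_subset_of_card_le hsub (by omega)) ▸ he)
      refine ⟨f, ⟨hf, hf'⟩, insert f (T.erase e), by push_cast; rfl, ?_⟩
      rw [Finset.card_insert_of_notMem (fun h => hf' (Finset.mem_of_mem_erase h)),
        Finset.card_erase_add_one he, hT])
    (fun _ _ => Set.subset_univ _)

/-- `U_n^{a,b} = U_{nb, n(a+b)}`. -/
def uniformAB (a b n : ℕ) : Matroid (Fin (n * (a + b))) :=
  uniform (n * b) (n * (a + b)) (Nat.mul_le_mul_left n (Nat.le_add_left b a))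

/-- For a partition `λ = (λ_1, …, λ_k)` of `n`, the direct sum
`U_λ^{a,b} = U_{λ_1}^{a,b} ⊕ ⋯ ⊕ U_{λ_k}^{a,b}`, one summand for each part of the multiset `λ`. -/
def uniformSum (a b : ℕ) {n : ℕ} (p : n.Partition) :
    Matroid ((i : p.parts) × Fin (i.1 * (a + b))) :=
  Matroid.sigma fun i : p.parts => uniformAB a b i.1

/-- `z_λ = ∏_{i=1}^n i^{α_i} α_i!`, where `α_i` is the number of appearances of `i` in `λ`. -/
def zee {n : ℕ} (p : n.Partition) : ℕ :=
  ∏ i ∈ Finset.Icc 1 n, i ^ p.parts.count i * (p.parts.count i)!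

end CatalanMatroid

end

/-! Cut the ground set of the Catalan matroid into `n` blocks of size `c = a + b`. A subset `A`
becomes a walk from 0 whose step at a block `B` is `|A ∩ B| - b`. The corank of `A` is minus the
minimum of the walk, and its nullity is the final height above that minimum
(`catalan_eRk_add_depth`). For a uniform matroid the corank and nullity are the negative and
positive parts of the final height alone (`map_tutte_uniformAB`).

After the substitution `x - 1 ↦ x`, `y - 1 ↦ y`, the theorem is therefore the Baxter–Spitzer
identity: the generating function of walks by depth and by height above the minimum is `exp (∑ t ^ m
/ m * splitSign (f ^ m))`, with `f` the step enumerator. It holds because both sides evolve by the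
same linear operator `walkStep` (`walkSum_succ`, `walkStep_partitionSum`). On the exponential side
this is a Wiener–Hopf factorization of `1 / (1 - f t)`. The sum over partitions with weights `1 /
z_λ` is the coefficient of the exponential. -/

noncomputable section

namespace CatalanMatroid

/-! ### Sums over partitions weighted by `1 / z_λ` -/

section PartitionSum

variable {R : Type*} [CommRing R] [Algebra ℚ R]

/-- The coefficient of `t ^ n` in `exp (∑ m ≥ 1, u m * t ^ m / m)`, written as a sum over
partitions. -/
def partitionSum (u : ℕ → R) (n : ℕ) : R :=
  ∑ p : n.Partition, (1 / (zee p : ℚ)) • (p.parts.map u).prod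

theorem map_partitionSum {S : Type*} [CommRing S] [Algebra ℚ S] (f : R →ₐ[ℚ] S) (u : ℕ → R)
    (n : ℕ) : f (partitionSum u n) = partitionSum (fun m => f (u m)) n := by
  simp [partitionSum, map_sum, map_smul, map_multiset_prod, Multiset.map_map]

theorem partitionSum_zero (u : ℕ → R) : partitionSum u 0 = 1 := by
  simp [partitionSum, zee, Nat.Partition.partition_zero_parts]

theorem zee_pos {n : ℕ} (p : n.Partition) : 0 < zee p :=
  Finset.prod_pos fun _ hi => Nat.mul_pos (Nat.pow_pos (Finset.mem_Icc.1 hi).1)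
    (Nat.factorial_pos _)

/-- The partition of `n + 1` obtained by adding a part `i + 1` to a partition of `j`. -/
def consPart {i j n : ℕ} (h : i + j = n) (p : j.Partition) : (n + 1).Partition where
  parts := (i + 1) ::ₘ p.parts
  parts_pos := by
    intro k hk
    rcases Multiset.mem_cons.1 hk with rfl | hk
    · exact Nat.succ_pos _
    · exact p.parts_pos hk
  parts_sum := by rw [Multiset.sum_cons, p.parts_sum]; omega

theorem zee_consPart {i j n : ℕ} (h : i + j = n) (p : j.Partition) :
    zee (consPart h p) = (i + 1) * (p.parts.count (i + 1) + 1) * zee p := by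
  -- Both products are put over the same range; sizes that do not occur contribute the factor 1.
  have hz : zee p = ∏ k ∈ Finset.Icc 1 (n + 1), k ^ p.parts.count k * (p.parts.count k)! := by
    refine Finset.prod_subset (Finset.Icc_subset_Icc le_rfl (by omega)) fun k hk hk' => ?_
    have : k ∉ p.parts := fun hmem => hk' <| Finset.mem_Icc.2
      ⟨p.parts_pos hmem, (Multiset.single_le_sum (by simp) _ hmem).trans_eq p.parts_sum⟩
    simp [Multiset.count_eq_zero_of_notMem this]
  have hi : i + 1 ∈ Finset.Icc 1 (n + 1) := Finset.mem_Icc.2 ⟨by omega, by omega⟩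
  rw [hz, zee, ← Finset.mul_prod_erase _ _ hi, ← Finset.mul_prod_erase _ _ hi, ← mul_assoc]
  congr 1
  · simp only [consPart, Multiset.count_cons_self, pow_succ, Nat.factorial_succ]
    ring
  · refine Finset.prod_congr rfl fun k hk => ?_
    simp [consPart, Multiset.count_cons_of_ne (Finset.ne_of_mem_erase hk)]

/-- Partitions without a part `i + 1` have weight 0, and `consPart` is a bijection onto the others.
The weight cancels exactly the ratio of the two values of `zee`. -/
theorem sum_count_mul {i j n : ℕ} (h : i + j = n) (u : ℕ → R) :
    ∑ p : (n + 1).Partition,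
      (((i + 1) * p.parts.count (i + 1) : ℕ) : ℚ) • (1 / (zee p : ℚ)) • (p.parts.map u).prod =
      u (i + 1) * partitionSum u j := by
  rw [partitionSum, Finset.mul_sum]
  symm
  refine Finset.sum_of_injOn (consPart h) ?_ (fun _ _ => Finset.mem_coe.2 (Finset.mem_univ _))
    ?_ ?_
  · intro p _ q _ hpq
    have := congrArg Nat.Partition.parts hpq
    exact Nat.Partition.ext ((Multiset.cons_inj_right _).1 this)
  · intro p _ hp
    have : i + 1 ∉ p.parts := by
      intro hmem
      refine hp ⟨⟨p.parts.erase (i + 1), fun hk => p.parts_pos (Multiset.mem_of_mem_erase hk), ?_⟩,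
        Finset.mem_coe.2 (Finset.mem_univ _), ?_⟩
      · have := Multiset.sum_erase hmem
        rw [p.parts_sum] at this
        omega
      · exact Nat.Partition.ext (Multiset.cons_erase hmem)
    simp [Multiset.count_eq_zero_of_notMem this]
  · intro p _
    have hz : (zee p : ℚ) ≠ 0 := by exact_mod_cast (zee_pos p).ne'
    rw [zee_consPart, smul_smul, mul_smul_comm]
    simp only [consPart, Multiset.count_cons_self, Multiset.map_cons, Multiset.prod_cons]
    congr 1
    push_cast
    have h1 : (i : ℚ) + 1 ≠ 0 := by positivity
    have h2 : (p.parts.count (i + 1) : ℚ) + 1 ≠ 0 := by positivity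
    field_simp

/-- In each partition of `n + 1`, the sizes times their multiplicities add up to `n + 1`; distribute
this factor over the sizes. This is the coefficient form of `C' = U' * C` for `C = exp U`. -/
theorem partitionSum_succ (u : ℕ → R) (n : ℕ) :
    ((n + 1 : ℕ) : ℚ) • partitionSum u (n + 1) =
      ∑ ij ∈ Finset.HasAntidiagonal.antidiagonal n, u (ij.1 + 1) * partitionSum u ij.2 := by
  rw [Finset.sum_congr rfl fun ij hij =>
      (sum_count_mul (Finset.HasAntidiagonal.mem_antidiagonal.1 hij) u).symm,
    Finset.sum_comm, partitionSum, Finset.smul_sum]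
  refine Finset.sum_congr rfl fun p _ => ?_
  rw [← Finset.sum_smul]
  congr 1
  rw [← Nat.cast_sum]
  congr 1
  have h1 := Finset.sum_multiset_count_of_subset p.parts (Finset.range (n + 2)) (by
    intro k hk
    have := Multiset.single_le_sum (by simp) _ (Multiset.mem_toFinset.1 hk)
    rw [p.parts_sum] at this
    exact Finset.mem_range.2 (by omega))
  rw [p.parts_sum, Finset.sum_range_succ'] at h1
  rw [Finset.Nat.sum_antidiagonal_eq_sum_range_succ
    (fun i _ => (i + 1) * p.parts.count (i + 1))]
  refine h1.trans ?_
  simp [mul_comm]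

theorem eq_partitionSum {u c : ℕ → R} (h0 : c 0 = 1)
    (h : ∀ n, ((n + 1 : ℕ) : ℚ) • c (n + 1) =
      ∑ ij ∈ Finset.HasAntidiagonal.antidiagonal n, u (ij.1 + 1) * c ij.2) (n : ℕ) :
    c n = partitionSum u n := by
  induction n using Nat.strong_induction_on with
  | _ n ih =>
    rcases n with - | n
    · rw [h0, partitionSum_zero]
    · have hn : ((n + 1 : ℕ) : ℚ) ≠ 0 := by positivity
      have : ((n + 1 : ℕ) : ℚ) • c (n + 1) = ((n + 1 : ℕ) : ℚ) • partitionSum u (n + 1) := by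
        rw [h, partitionSum_succ]
        refine Finset.sum_congr rfl fun ij hij => ?_
        rw [ih ij.2 (by have := Finset.HasAntidiagonal.mem_antidiagonal.1 hij; omega)]
      exact (isUnit_iff_ne_zero.2 hn).smul_left_cancel.1 this

/-- The power series `exp (∑ m ≥ 1, u m * t ^ m / m)`. -/
def partitionSeries (u : ℕ → R) : PowerSeries R := PowerSeries.mk (partitionSum u)

theorem coeff_partitionSeries (u : ℕ → R) (n : ℕ) :
    PowerSeries.coeff n (partitionSeries u) = partitionSum u n := PowerSeries.coeff_mk _ _

/-- The differential equation, with constant term 1, characterizes the exponential. The laws of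
exponentials below are all deduced from this uniqueness. -/
theorem derivative_eq_mul_iff (u : ℕ → R) (C : PowerSeries R) :
    PowerSeries.derivative R C = PowerSeries.mk (fun m => u (m + 1)) * C ↔
      ∀ n, ((n + 1 : ℕ) : ℚ) • PowerSeries.coeff (n + 1) C =
        ∑ ij ∈ Finset.HasAntidiagonal.antidiagonal n, u (ij.1 + 1) * PowerSeries.coeff ij.2 C := by
  rw [PowerSeries.ext_iff]
  refine forall_congr' fun n => ?_
  rw [PowerSeries.coeff_derivative, PowerSeries.coeff_mul, Algebra.smul_def, map_natCast, mul_comm]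
  simp [PowerSeries.coeff_mk]

theorem derivative_partitionSeries (u : ℕ → R) :
    PowerSeries.derivative R (partitionSeries u) =
      PowerSeries.mk (fun m => u (m + 1)) * partitionSeries u := by
  simpa [derivative_eq_mul_iff, coeff_partitionSeries] using partitionSum_succ u

theorem eq_partitionSeries {u : ℕ → R} {C : PowerSeries R} (h0 : PowerSeries.constantCoeff C = 1)
    (h : PowerSeries.derivative R C = PowerSeries.mk (fun m => u (m + 1)) * C) :
    C = partitionSeries u := by
  ext n
  rw [coeff_partitionSeries]
  exact eq_partitionSum (c := fun n => PowerSeries.coeff n C)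
    (by simpa using h0) ((derivative_eq_mul_iff u C).1 h) n

theorem constantCoeff_partitionSeries (u : ℕ → R) :
    PowerSeries.constantCoeff (partitionSeries u) = 1 := by
  rw [← PowerSeries.coeff_zero_eq_constantCoeff_apply, coeff_partitionSeries, partitionSum_zero]

theorem partitionSeries_add (u v : ℕ → R) :
    partitionSeries (fun m => u m + v m) = partitionSeries u * partitionSeries v := by
  refine (eq_partitionSeries ?_ ?_).symm
  · simp [constantCoeff_partitionSeries]
  · have : PowerSeries.mk (fun m => u (m + 1) + v (m + 1)) =
        PowerSeries.mk (fun m => u (m + 1)) + PowerSeries.mk (fun m => v (m + 1)) := by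
      ext; simp
    rw [Derivation.leibniz, derivative_partitionSeries, derivative_partitionSeries, this]
    simp only [smul_eq_mul]
    ring

theorem partitionSeries_mul_neg (u : ℕ → R) :
    partitionSeries u * partitionSeries (fun m => -u m) = 1 := by
  rw [← partitionSeries_add]
  refine (eq_partitionSeries (by simp) ?_).symm
  ext n
  simp

/-- This is `exp (-log (1 - f t)) = 1 / (1 - f t)`. -/
theorem partitionSeries_pow (f : R) :
    partitionSeries (fun m => f ^ m) = PowerSeries.mk fun m => f ^ m := by
  refine (eq_partitionSeries (by simp [← PowerSeries.coeff_zero_eq_constantCoeff_apply]) ?_).symm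
  rw [derivative_eq_mul_iff]
  intro n
  simp only [PowerSeries.coeff_mk]
  rw [Finset.sum_congr rfl (g := fun _ => f ^ (n + 1)) fun ij hij => by
    rw [← pow_add, ← Finset.HasAntidiagonal.mem_antidiagonal.1 hij]; ring_nf]
  simp [Algebra.smul_def]

end PartitionSum

/-! ### Ranks in Schubert and uniform matroids -/

section Rank

theorem schubert_isBase_iff {m : ℕ} {S T : Finset (Fin m)} :
    (schubert S).IsBase (T : Set (Fin m)) ↔ SubsetLE T S := by
  change (∃ T' : Finset (Fin m), (T' : Set (Fin m)) = T ∧ SubsetLE T' S) ↔ _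
  exact ⟨fun ⟨T', h, hT'⟩ => Finset.coe_injective h ▸ hT', fun h => ⟨T, rfl, h⟩⟩

theorem subsetLE_iff_lt {m : ℕ} (T S : Finset (Fin m)) :
    SubsetLE T S ↔ T.card = S.card ∧
      ∀ j : ℕ, (S.filter (fun i : Fin m => (i : ℕ) < j)).card ≤
        (T.filter (fun i : Fin m => (i : ℕ) < j)).card := by
  rw [subsetLE_iff]
  refine and_congr_right fun hc => ⟨fun h j => ?_, fun h j => ?_⟩
  · rcases j with - | j
    · simp
    · by_cases hj : j < m
      · have := h ⟨j, hj⟩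
        simpa only [Fin.le_def, ← Nat.lt_succ_iff] using this
      · have key : ∀ U : Finset (Fin m), U.filter (fun i : Fin m => (i : ℕ) < j + 1) = U := fun U =>
          Finset.filter_true_of_mem fun i _ => by omega
        rw [key, key, hc]
  · simpa only [Fin.le_def, ← Nat.lt_succ_iff] using h (j + 1)

theorem card_filter_lt_add {m : ℕ} (U : Finset (Fin m)) (j : ℕ) :
    (U.filter (fun i : Fin m => (i : ℕ) < j)).card +
        (U.filter (fun i : Fin m => ¬ (i : ℕ) < j)).card = U.card :=
  Finset.card_filter_add_card_filter_not _

/-- A set together with a base meeting it in a basis. -/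
theorem exists_isBase_inter_card {m : ℕ} (M : Matroid (Fin m)) (hE : M.E = Set.univ)
    (A : Finset (Fin m)) : ∃ T : Finset (Fin m), M.IsBase (T : Set (Fin m)) ∧
      (M.eRk (A : Set (Fin m))).toNat = (T ∩ A).card ∧
      ∀ T' : Finset (Fin m), M.IsBase (T' : Set (Fin m)) → (T' ∩ A).card ≤ (T ∩ A).card := by
  obtain ⟨I, hI⟩ := M.exists_isBasis (A : Set (Fin m)) (by simp [hE])
  obtain ⟨B, hB, hIB⟩ := hI.exists_isBase
  lift B to Finset (Fin m) using B.toFinite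
  have hr : M.eRk (A : Set (Fin m)) = ((B ∩ A).card : ℕ∞) := by
    rw [← hI.encard_eq_eRk, hIB, ← Set.encard_coe_eq_coe_finsetCard]
    congr 1
    simp
  refine ⟨B, hB, by rw [hr]; rfl, fun T' hT' => ?_⟩
  have h1 : ((T' ∩ A : Finset (Fin m)) : Set (Fin m)).encard ≤ M.eRk (A : Set (Fin m)) :=
    (hT'.indep.subset (by simp)).encard_le_eRk_of_subset (by simp)
  rw [hr, Set.encard_coe_eq_coe_finsetCard] at h1
  exact_mod_cast h1

/-- Cut a base `T` at `j`: the lower part of `T ∩ A` lies in `A`, and `T` has at most as many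
elements as `S` from `j` on. -/
theorem schubert_eRk_le {m : ℕ} (S A : Finset (Fin m)) (j : ℕ) :
    ((schubert S).eRk (A : Set (Fin m))).toNat ≤
      (A.filter (fun i : Fin m => (i : ℕ) < j)).card +
        (S.filter (fun i : Fin m => ¬ (i : ℕ) < j)).card := by
  obtain ⟨T, hT, hr, -⟩ := exists_isBase_inter_card (schubert S) rfl A
  rw [schubert_isBase_iff, subsetLE_iff_lt] at hT
  have h1 := card_filter_lt_add (T ∩ A) j
  have h2 := card_filter_lt_add S j
  have h3 := card_filter_lt_add T j
  have h4 := hT.2 j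
  have h5 : ((T ∩ A).filter (fun i : Fin m => (i : ℕ) < j)).card ≤
      (A.filter (fun i : Fin m => (i : ℕ) < j)).card :=
    Finset.card_le_card (Finset.filter_subset_filter _ Finset.inter_subset_right)
  have h6 : ((T ∩ A).filter (fun i : Fin m => ¬ (i : ℕ) < j)).card ≤
      (T.filter (fun i : Fin m => ¬ (i : ℕ) < j)).card :=
    Finset.card_le_card (Finset.filter_subset_filter _ Finset.inter_subset_left)
  have := hT.1
  omega

/-- Take a base `T` with `T ∩ A` largest, `f` the least element of `A \ T` and `e` the greatest of
`T \ A`. Exchanging `e` for `f` would enlarge the intersection, so the result violates the prefix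
condition at some `j`. This forces `e < j ≤ f` and makes the prefix condition for `T` an equality at
`j`. Below `j`, `T` contains `A`; from `j` on, `A` contains `T`. -/
theorem exists_schubert_eRk_eq {m : ℕ} (S A : Finset (Fin m)) :
    ∃ j ≤ m, ((schubert S).eRk (A : Set (Fin m))).toNat =
      (A.filter (fun i : Fin m => (i : ℕ) < j)).card +
        (S.filter (fun i : Fin m => ¬ (i : ℕ) < j)).card := by
  obtain ⟨T, hT, hr, hmax⟩ := exists_isBase_inter_card (schubert S) rfl A
  rw [hr]
  rw [schubert_isBase_iff, subsetLE_iff_lt] at hT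
  rcases (A \ T).eq_empty_or_nonempty with hA | hA
  · refine ⟨m, le_rfl, ?_⟩
    rw [Finset.sdiff_eq_empty_iff_subset] at hA
    rw [Finset.inter_eq_right.2 hA, Finset.filter_true_of_mem fun i _ => i.2,
      Finset.filter_false_of_mem fun i _ => not_not.2 i.2]
    simp
  rcases (T \ A).eq_empty_or_nonempty with hTA | hTA
  · refine ⟨0, Nat.zero_le _, ?_⟩
    rw [Finset.sdiff_eq_empty_iff_subset] at hTA
    simp [Finset.inter_eq_left.2 hTA, hT.1]
  obtain ⟨f, hf⟩ : ∃ f, f = (A \ T).min' hA := ⟨_, rfl⟩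
  obtain ⟨e, he⟩ : ∃ e, e = (T \ A).max' hTA := ⟨_, rfl⟩
  have hfm := hf ▸ Finset.min'_mem _ hA
  have hem := he ▸ Finset.max'_mem _ hTA
  rw [Finset.mem_sdiff] at hfm hem
  have hfmin : ∀ x ∈ A, x ∉ T → f ≤ x := fun x h1 h2 =>
    hf ▸ Finset.min'_le _ _ (Finset.mem_sdiff.2 ⟨h1, h2⟩)
  have hemax : ∀ x ∈ T, x ∉ A → x ≤ e := fun x h1 h2 =>
    he ▸ Finset.le_max' _ _ (Finset.mem_sdiff.2 ⟨h1, h2⟩)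
  have hfe : f ∉ T.erase e := fun h => hfm.2 (Finset.mem_of_mem_erase h)
  have hnot : ¬ SubsetLE (insert f (T.erase e)) S := by
    intro h
    have h1 := hmax _ (schubert_isBase_iff.2 h)
    have h2 : insert f (T ∩ A) ⊆ insert f (T.erase e) ∩ A := by
      intro x hx
      rw [Finset.mem_insert, Finset.mem_inter] at hx
      rw [Finset.mem_inter, Finset.mem_insert, Finset.mem_erase]
      rcases hx with rfl | hx
      · exact ⟨Or.inl rfl, hfm.1⟩
      · exact ⟨Or.inr ⟨fun h => hem.2 (h ▸ hx.2), hx.1⟩, hx.2⟩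
    have h3 := Finset.card_le_card h2
    rw [Finset.card_insert_of_notMem (by simp [hfm.2])] at h3
    omega
  rw [subsetLE_iff_lt, Finset.card_insert_of_notMem hfe, Finset.card_erase_add_one hem.1] at hnot
  push Not at hnot
  obtain ⟨j, hj⟩ := hnot hT.1
  have hTj := hT.2 j
  have hej : (e : ℕ) < j := by
    by_contra hej
    have : T.filter (fun i : Fin m => (i : ℕ) < j) ⊆
        (insert f (T.erase e)).filter (fun i : Fin m => (i : ℕ) < j) := by
      intro x hx
      rw [Finset.mem_filter] at hx ⊢
      exact ⟨Finset.mem_insert_of_mem (Finset.mem_erase.2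
        ⟨fun h => hej (h ▸ hx.2), hx.1⟩), hx.2⟩
    have := Finset.card_le_card this
    omega
  have hsub : (T.filter (fun i : Fin m => (i : ℕ) < j)).card ≤
      ((T.erase e).filter (fun i : Fin m => (i : ℕ) < j)).card + 1 := by
    rw [Finset.filter_erase]
    have := Finset.pred_card_le_card_erase (s := T.filter (fun i : Fin m => (i : ℕ) < j)) (a := e)
    omega
  have hjf : j ≤ (f : ℕ) := by
    by_contra! hjf
    rw [Finset.filter_insert, if_pos hjf, Finset.card_insert_of_notMem
      (fun h => hfe (Finset.mem_of_mem_filter _ h))] at hj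
    omega
  rw [Finset.filter_insert, if_neg (by omega)] at hj
  refine ⟨j, hjf.trans f.2.le, ?_⟩
  have h1 := card_filter_lt_add (T ∩ A) j
  have h2 := card_filter_lt_add S j
  have h3 := card_filter_lt_add T j
  have h5 : (T ∩ A).filter (fun i : Fin m => (i : ℕ) < j) =
      A.filter (fun i : Fin m => (i : ℕ) < j) := by
    ext x
    simp only [Finset.mem_filter, Finset.mem_inter]
    refine ⟨fun h => ⟨h.1.2, h.2⟩, fun h => ⟨⟨?_, h.1⟩, h.2⟩⟩
    by_contra hx
    have := Fin.le_def.1 (hfmin x h.1 hx)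
    omega
  have h6 : (T ∩ A).filter (fun i : Fin m => ¬ (i : ℕ) < j) =
      T.filter (fun i : Fin m => ¬ (i : ℕ) < j) := by
    ext x
    simp only [Finset.mem_filter, Finset.mem_inter]
    refine ⟨fun h => ⟨h.1.1, h.2⟩, fun h => ⟨⟨h.1, ?_⟩, h.2⟩⟩
    by_contra hx
    have := Fin.le_def.1 (hemax x h.1 hx)
    omega
  have := hT.1
  rw [h5, h6] at h1
  omega

theorem uniform_isBase_iff {k m : ℕ} {h : k ≤ m} {T : Finset (Fin m)} :
    (uniform k m h).IsBase (T : Set (Fin m)) ↔ T.card = k := by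
  change (∃ T' : Finset (Fin m), (T' : Set (Fin m)) = T ∧ T'.card = k) ↔ _
  exact ⟨fun ⟨T', h, hT'⟩ => Finset.coe_injective h ▸ hT', fun h => ⟨T, rfl, h⟩⟩

theorem uniform_eRk {k m : ℕ} (h : k ≤ m) (A : Finset (Fin m)) :
    ((uniform k m h).eRk (A : Set (Fin m))).toNat = min A.card k := by
  obtain ⟨T, hT, hr, hmax⟩ := exists_isBase_inter_card (uniform k m h) rfl A
  rw [uniform_isBase_iff] at hT
  rw [hr]
  refine le_antisymm (le_min (Finset.card_le_card Finset.inter_subset_right)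
    ((Finset.card_le_card Finset.inter_subset_left).trans_eq hT)) ?_
  rcases le_total A.card k with hA | hA
  · obtain ⟨B, hAB, -, hB⟩ := Finset.exists_subsuperset_card_eq (Finset.subset_univ A) hA
      (by simpa using h)
    have := hmax B (uniform_isBase_iff.2 hB)
    rw [Finset.inter_eq_right.2 hAB] at this
    rwa [min_eq_left hA]
  · obtain ⟨B, hBA, hB⟩ := Finset.exists_subset_card_eq hA
    have := hmax B (uniform_isBase_iff.2 hB)
    rw [Finset.inter_eq_left.2 hBA, hB] at this
    rwa [min_eq_right hA]

end Rank

/-! ### Direct sums -/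

section DirectSum

variable {ι : Type*} [Fintype ι] {α : ι → Type*} [∀ i, Fintype (α i)]

theorem sigma_eRk_toNat (M : ∀ i, Matroid (α i)) (A : Finset ((i : ι) × α i))
    (hA : ∀ i, Sigma.mk i ⁻¹' (A : Set ((i : ι) × α i)) ⊆ (M i).E) :
    ((Matroid.sigma M).eRk (A : Set ((i : ι) × α i))).toNat =
      ∑ i, ((M i).eRk (Sigma.mk i ⁻¹' (A : Set ((i : ι) × α i)))).toNat := by
  classical
  choose I hI using fun i => (M i).exists_isBasis _ (hA i)
  have hJ : (Matroid.sigma M).IsBasis (Set.univ.sigma I) (A : Set ((i : ι) × α i)) := by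
    rw [Matroid.sigma_isBasis_iff]
    intro i
    simpa using hI i
  have hfin : Set.univ.sigma I = ((Finset.univ.sigma fun i => (I i).toFinset : Finset _) :
      Set ((i : ι) × α i)) := by
    ext; simp
  rw [← hJ.encard_eq_eRk, hfin, Set.encard_coe_eq_coe_finsetCard, Finset.card_sigma]
  simp only [ENat.toNat_natCast]
  refine Finset.sum_congr rfl fun i _ => ?_
  rw [← (hI i).encard_eq_eRk, Set.encard_eq_coe_toFinset_card, ENat.toNat_natCast]

theorem tutte_of_ground_eq_univ {β : Type*} [Fintype β] (M : Matroid β) [M.Finite]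
    (hE : M.E = Set.univ) : tutte M = ∑ A : Finset β,
      (MvPolynomial.X 0 - 1) ^ ((M.eRk Set.univ).toNat - (M.eRk (A : Set β)).toNat) *
      (MvPolynomial.X 1 - 1) ^ (A.card - (M.eRk (A : Set β)).toNat) := by
  classical
  rw [tutte]
  have : M.ground_finite.toFinset.powerset = Finset.univ := by
    ext; simp [hE]
  rw [this, hE]

theorem eRk_toNat_mono {β : Type*} [Finite β] (M : Matroid β) {X Y : Set β} (h : X ⊆ Y) :
    (M.eRk X).toNat ≤ (M.eRk Y).toNat := by
  refine ENat.toNat_le_toNat (M.eRk_mono h) (ne_top_of_le_ne_top ?_ (M.eRk_le_encard Y))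
  exact Set.encard_ne_top_iff.2 (Set.toFinite Y)

theorem eRk_toNat_le_card {β : Type*} (M : Matroid β) (A : Finset β) :
    (M.eRk (A : Set β)).toNat ≤ A.card := by
  have := M.eRk_le_encard (A : Set β)
  rw [Set.encard_coe_eq_coe_finsetCard] at this
  exact ENat.toNat_le_of_le_natCast this

theorem tutte_sigma [∀ i, DecidableEq (α i)] [DecidableEq ι] (M : ∀ i, Matroid (α i))
    [∀ i, (M i).Finite]
    [(Matroid.sigma M).Finite] (hE : ∀ i, (M i).E = Set.univ) :
    tutte (Matroid.sigma M) = ∏ i, tutte (M i) := by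
  rw [tutte_of_ground_eq_univ _ (by ext; simp [hE])]
  rw [Finset.prod_congr rfl fun i _ => tutte_of_ground_eq_univ (M i) (hE i),
    Finset.prod_univ_sum]
  symm
  refine Finset.sum_nbij' (fun B => Finset.univ.sigma B)
    (fun A i => Finset.univ.filter fun x => (⟨i, x⟩ : (i : ι) × α i) ∈ A) ?_ ?_ ?_ ?_ ?_
  · simp
  · simp
  · intro B _
    ext; simp
  · intro A _
    ext; simp
  · intro B _
    have huniv : ((Matroid.sigma M).eRk Set.univ).toNat = ∑ i, ((M i).eRk Set.univ).toNat := by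
      have := sigma_eRk_toNat M Finset.univ (fun i => by simp [hE])
      simpa using this
    have hB : ((Matroid.sigma M).eRk ((Finset.univ.sigma B : Finset _) :
        Set ((i : ι) × α i))).toNat = ∑ i, ((M i).eRk (B i : Set (α i))).toNat := by
      rw [sigma_eRk_toNat M _ (fun i => by simp [hE])]
      refine Finset.sum_congr rfl fun i _ => ?_
      congr 2
      ext; simp
    -- Corank and nullity add over the summands because no difference is truncated.
    rw [huniv, hB, Finset.card_sigma, ← Finset.sum_tsub_distrib _ (fun i _ =>
      eRk_toNat_mono _ (Set.subset_univ _)), ← Finset.sum_tsub_distrib _ (fun i _ =>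
      eRk_toNat_le_card _ _), Finset.prod_mul_distrib, Finset.prod_pow_eq_pow_sum,
      Finset.prod_pow_eq_pow_sum]

theorem tutte_uniformSum (a b : ℕ) {n : ℕ} (p : n.Partition) :
    tutte (uniformSum a b p) = (p.parts.map fun k => tutte (uniformAB a b k)).prod := by
  classical
  rw [uniformSum, tutte_sigma _ fun i => rfl]
  conv_rhs => rw [← Multiset.map_univ_coe p.parts, Multiset.map_map]
  rfl

end DirectSum

/-! ### The Baxter–Spitzer identity -/

section Spitzer

open LaurentPolynomial

/-- The linear map `z ^ h ↦ x ^ (h⁻) y ^ (h⁺)`. -/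
def splitSign : ℚ[T;T⁻¹] →ₗ[ℚ] MvPolynomial (Fin 2) ℚ :=
  (Finsupp.lift (MvPolynomial (Fin 2) ℚ) ℚ ℤ fun h =>
    MvPolynomial.X 0 ^ (-h).toNat * MvPolynomial.X 1 ^ h.toNat) ∘ₗ
    (AddMonoidAlgebra.coeffLinearEquiv ℚ).toLinearMap

theorem splitSign_T (h : ℤ) :
    splitSign (T h) = MvPolynomial.X 0 ^ (-h).toNat * MvPolynomial.X 1 ^ h.toNat := by
  simp [splitSign, T, -single_eq_C_mul_T]

/-- `splitSign` is not multiplicative, but on polynomials in `z⁻¹` alone, or in `z` alone, it is a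
substitution. -/
theorem splitSign_neg (q : Polynomial ℚ) :
    splitSign (Polynomial.aeval (T (-1)) q) = Polynomial.aeval (MvPolynomial.X 0) q := by
  induction q using Polynomial.induction_on' with
  | add p q hp hq => simp [hp, hq]
  | monomial n c =>
    simp only [Polynomial.aeval_monomial, ← Algebra.smul_def, map_smul, T_pow, splitSign_T]
    simp

theorem splitSign_pos (q : Polynomial ℚ) :
    splitSign (Polynomial.aeval (T 1) q) = Polynomial.aeval (MvPolynomial.X 1) q := by
  induction q using Polynomial.induction_on' with
  | add p q hp hq => simp [hp, hq]
  | monomial n c =>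
    simp only [Polynomial.aeval_monomial, ← Algebra.smul_def, map_smul, T_pow, splitSign_T]
    simp

/-- The constant term may be put on either side, since `splitSign` treats it the same way in both.
-/
theorem exists_eq_neg_add_pos (g : ℚ[T;T⁻¹]) : ∃ p q : Polynomial ℚ,
    g = Polynomial.aeval (T (-1) : ℚ[T;T⁻¹]) p + Polynomial.aeval (T 1 : ℚ[T;T⁻¹]) q := by
  induction g using LaurentPolynomial.induction_on' with
  | add f g hf hg =>
    obtain ⟨p, q, rfl⟩ := hf
    obtain ⟨p', q', rfl⟩ := hg
    exact ⟨p + p', q + q', by simp only [map_add]; ring⟩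
  | C_mul_T n c =>
    obtain ⟨k, rfl | rfl⟩ := n.eq_nat_or_neg
    · exact ⟨0, Polynomial.monomial k c, by simp [Polynomial.aeval_monomial, T_pow]⟩
    · exact ⟨Polynomial.monomial k c, 0, by simp [Polynomial.aeval_monomial, T_pow]⟩

/-- One step of the reflected walk with step enumerator `f`: the linear map
`x ^ p y ^ q ↦ x ^ p * splitSign (f * z ^ q)`. -/
def walkStep (f : ℚ[T;T⁻¹]) : MvPolynomial (Fin 2) ℚ →ₗ[ℚ] MvPolynomial (Fin 2) ℚ :=
  (MvPolynomial.basisMonomials (Fin 2) ℚ).constr ℚ fun d =>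
    MvPolynomial.X 0 ^ d 0 * splitSign (f * T (d 1))

theorem walkStep_X_pow_mul (f : ℚ[T;T⁻¹]) (p q : ℕ) :
    walkStep f (MvPolynomial.X 0 ^ p * MvPolynomial.X 1 ^ q) =
      MvPolynomial.X 0 ^ p * splitSign (f * T q) := by
  have : (MvPolynomial.X 0 ^ p * MvPolynomial.X 1 ^ q : MvPolynomial (Fin 2) ℚ) =
      MvPolynomial.basisMonomials (Fin 2) ℚ (Finsupp.single 0 p + Finsupp.single 1 q) := by
    simp [MvPolynomial.X_pow_eq_monomial, MvPolynomial.monomial_mul]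
  rw [this, walkStep, Module.Basis.constr_basis]
  simp

theorem walkStep_aeval_mul (f : ℚ[T;T⁻¹]) (p q : Polynomial ℚ) :
    walkStep f (Polynomial.aeval (MvPolynomial.X 0) p * Polynomial.aeval (MvPolynomial.X 1) q) =
      Polynomial.aeval (MvPolynomial.X 0) p * splitSign (f * Polynomial.aeval (T 1) q) := by
  induction p using Polynomial.induction_on' with
  | add p p' hp hp' => simp [add_mul, hp, hp']
  | monomial n c =>
    induction q using Polynomial.induction_on' with
    | add q q' hq hq' => rw [map_add, map_add, mul_add, map_add, hq, hq', ← mul_add, ← map_add,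
        ← mul_add]
    | monomial m d =>
      simp only [Polynomial.aeval_monomial, ← Algebra.smul_def, smul_mul_assoc, mul_smul_comm,
        map_smul, walkStep_X_pow_mul, T_pow, mul_one]

/-- Write `f ^ m = α m (z⁻¹) + β m (z)`, and let `P` and `Q` be the exponentials of `∑ α m t ^ m /
m` and `∑ β m t ^ m / m`. Then `P(z⁻¹) Q(z) = 1 / (1 - f t)`, so `t f Q(z) = Q(z) - P(z⁻¹)⁻¹`. The
right side has no mixed terms, hence `t * walkStep f` sends `P(x) Q(y)` to `P(x) (Q(y) - P(x)⁻¹) =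
P(x) Q(y) - 1`. -/
theorem walkStep_partitionSum (f : ℚ[T;T⁻¹]) (n : ℕ) :
    walkStep f (partitionSum (fun m => splitSign (f ^ m)) n) =
      partitionSum (fun m => splitSign (f ^ m)) (n + 1) := by
  choose α β hαβ using fun m : ℕ => exists_eq_neg_add_pos (f ^ m)
  obtain ⟨iX, hiX⟩ : ∃ g : Polynomial ℚ →ₐ[ℚ] ℚ[T;T⁻¹], g = Polynomial.aeval (T (-1)) := ⟨_, rfl⟩
  obtain ⟨iY, hiY⟩ : ∃ g : Polynomial ℚ →ₐ[ℚ] ℚ[T;T⁻¹], g = Polynomial.aeval (T 1) := ⟨_, rfl⟩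
  obtain ⟨jX, hjX⟩ : ∃ g : Polynomial ℚ →ₐ[ℚ] MvPolynomial (Fin 2) ℚ,
    g = Polynomial.aeval (MvPolynomial.X 0) := ⟨_, rfl⟩
  obtain ⟨jY, hjY⟩ : ∃ g : Polynomial ℚ →ₐ[ℚ] MvPolynomial (Fin 2) ℚ,
    g = Polynomial.aeval (MvPolynomial.X 1) := ⟨_, rfl⟩
  have hf : ∀ m, f ^ m = iX (α m) + iY (β m) := fun m => by rw [hiX, hiY]; exact hαβ m
  have hu : (fun m => splitSign (f ^ m)) = fun m => jX (α m) + jY (β m) := by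
    funext m
    rw [hf, map_add, hiX, hiY, splitSign_neg, splitSign_pos, hjX, hjY]
  -- The factorization, in the form `Q (1 - f t) = P⁻¹`.
  have hlaurent : partitionSeries (fun m => iY (β m)) * (1 - PowerSeries.C f * PowerSeries.X) =
      partitionSeries fun m => iX (-α m) := by
    have h1 : partitionSeries (fun m => iX (α m)) * partitionSeries (fun m => iY (β m)) =
        PowerSeries.mk fun m => f ^ m := by
      rw [← partitionSeries_add, ← partitionSeries_pow]
      simp only [hf]
    have h2 : (PowerSeries.mk fun m => f ^ m) * (1 - PowerSeries.C f * PowerSeries.X) = 1 := by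
      ext n
      rcases n with - | n
      · simp
      · rw [mul_sub, mul_left_comm, mul_one, map_sub, PowerSeries.coeff_C_mul,
          PowerSeries.coeff_succ_mul_X]
        simp [PowerSeries.coeff_one, pow_succ']
    have h3 := partitionSeries_mul_neg (fun m => iX (α m))
    simp only [map_neg]
    calc _ = (partitionSeries (fun m => iX (α m)) * partitionSeries (fun m => -iX (α m))) *
          (partitionSeries (fun m => iY (β m)) * (1 - PowerSeries.C f * PowerSeries.X)) := by
            rw [h3, one_mul]
      _ = (partitionSeries (fun m => iX (α m)) * partitionSeries (fun m => iY (β m)) *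
          (1 - PowerSeries.C f * PowerSeries.X)) * partitionSeries (fun m => -iX (α m)) := by ring
      _ = _ := by rw [h1, h2, one_mul]
  have hstep : ∀ j, f * iY (partitionSum β j) =
      iY (partitionSum β (j + 1)) - iX (partitionSum (fun m => -α m) (j + 1)) := by
    intro j
    have := congrArg (PowerSeries.coeff (j + 1)) hlaurent
    rw [mul_sub, mul_left_comm, mul_one, map_sub, PowerSeries.coeff_C_mul,
      PowerSeries.coeff_succ_mul_X, coeff_partitionSeries, coeff_partitionSeries,
      coeff_partitionSeries] at this
    rw [map_partitionSum, map_partitionSum, map_partitionSum, ← this]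
    ring
  have hsplit : ∀ (v : ℕ → Polynomial ℚ) n, partitionSum (fun m => jX (α m) + jY (v m)) n =
      ∑ ij ∈ Finset.HasAntidiagonal.antidiagonal n,
        jX (partitionSum α ij.1) * jY (partitionSum v ij.2) := by
    intro v n
    rw [← coeff_partitionSeries, partitionSeries_add, PowerSeries.coeff_mul]
    simp only [coeff_partitionSeries, map_partitionSum]
  -- The coefficient of `t ^ (n + 1)` in `P(x) P(x)⁻¹ = 1`.
  have hcancel : ∑ ij ∈ Finset.HasAntidiagonal.antidiagonal (n + 1),
      jX (partitionSum α ij.1) * jX (partitionSum (fun m => -α m) ij.2) = 0 := by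
    have := congrArg (PowerSeries.coeff (n + 1)) (partitionSeries_mul_neg α)
    rw [PowerSeries.coeff_mul] at this
    simp only [coeff_partitionSeries] at this
    rw [PowerSeries.coeff_one, if_neg (Nat.succ_ne_zero n)] at this
    simpa using congrArg jX this
  rw [hu, hsplit, hsplit, map_sum]
  -- The terms with second index 0, split off here, are the same in both sums.
  rw [Finset.Nat.sum_antidiagonal_succ'] at hcancel ⊢
  have hterm : ∀ ij : ℕ × ℕ, walkStep f (jX (partitionSum α ij.1) * jY (partitionSum β ij.2)) =
      jX (partitionSum α ij.1) * jY (partitionSum β (ij.2 + 1)) -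
      jX (partitionSum α ij.1) * jX (partitionSum (fun m => -α m) (ij.2 + 1)) := by
    intro ij
    rw [hjX, hjY, walkStep_aeval_mul, ← hiY, hstep, map_sub, hiX, hiY, splitSign_neg,
      splitSign_pos, mul_sub]
  simp only [hterm, Finset.sum_sub_distrib, partitionSum_zero, map_one, mul_one] at hcancel ⊢
  linear_combination -hcancel

end Spitzer

/-! ### Tutte polynomials as enumerators of walks -/

section Walk

open LaurentPolynomial

theorem sum_powerset_T {ι : Type*} (s : Finset ι) (e : ℤ) :
    ∑ B ∈ s.powerset, (T ((B.card : ℤ) + e) : ℚ[T;T⁻¹]) = T e * (1 + T 1) ^ s.card := by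
  rw [Finset.sum_powerset_apply_card (fun k => (T ((k : ℤ) + e) : ℚ[T;T⁻¹])),
    add_comm (1 : ℚ[T;T⁻¹]), add_pow, Finset.mul_sum]
  refine Finset.sum_congr rfl fun k _ => ?_
  rw [T_add, T_pow, one_pow, nsmul_eq_mul]
  simp only [mul_one]
  ring

theorem sum_powerset_union {ι M : Type*} [DecidableEq ι] [AddCommMonoid M] {s t : Finset ι}
    (h : Disjoint s t) (g : Finset ι → M) :
    ∑ C ∈ (s ∪ t).powerset, g C = ∑ A ∈ s.powerset, ∑ B ∈ t.powerset, g (A ∪ B) := by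
  rw [← Finset.sum_product']
  symm
  refine Finset.sum_nbij' (fun AB => AB.1 ∪ AB.2) (fun C => (C ∩ s, C ∩ t)) ?_ ?_ ?_ ?_ ?_
  · rintro ⟨A, B⟩ h
    simp only [Finset.mem_product, Finset.mem_powerset] at h ⊢
    exact Finset.union_subset_union h.1 h.2
  · intro C _
    simp
  · rintro ⟨A, B⟩ hAB
    simp only [Finset.mem_product, Finset.mem_powerset] at hAB
    have h1 : B ∩ s = ∅ := Finset.disjoint_iff_inter_eq_empty.1 (h.symm.mono_left hAB.2)
    have h2 : A ∩ t = ∅ := Finset.disjoint_iff_inter_eq_empty.1 (h.mono_left hAB.1)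
    simp [Finset.union_inter_distrib_right, h1, h2, Finset.inter_eq_left.2 hAB.1,
      Finset.inter_eq_left.2 hAB.2]
  · intro C hC
    rw [Finset.mem_powerset] at hC
    simp [← Finset.inter_union_distrib_left, Finset.inter_eq_left.2 hC]
  · simp

/-- The number of elements of `A` below `j`. -/
def countBelow (A : Finset ℕ) (j : ℕ) : ℕ := (A.filter (· < j)).card

/-- The largest value of `k * b - |A ∩ [0, k * c)|` over `k ≤ n`. -/
def depth (b c : ℕ) (A : Finset ℕ) : ℕ → ℕ
  | 0 => 0
  | n + 1 => max (depth b c A n) ((n + 1) * b - countBelow A ((n + 1) * c))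

/-- Together with `exists_depth_eq` this characterizes `depth`. The truncated subtraction in its
definition is harmless, since `k = 0` already contributes 0 to the maximum. -/
theorem le_depth (b c : ℕ) (A : Finset ℕ) {k n : ℕ} (h : k ≤ n) :
    k * b ≤ depth b c A n + countBelow A (k * c) := by
  induction n with
  | zero => simp [Nat.le_zero.1 h]
  | succ n ih =>
    rcases Nat.le_succ_iff.1 h with h | rfl
    · have := ih h
      have := le_max_left (depth b c A n) ((n + 1) * b - countBelow A ((n + 1) * c))
      rw [depth]
      omega
    · have := le_max_right (depth b c A n) ((n + 1) * b - countBelow A ((n + 1) * c))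
      rw [depth, Nat.succ_eq_add_one]
      omega

theorem exists_depth_eq (b c : ℕ) (A : Finset ℕ) (n : ℕ) :
    ∃ k ≤ n, depth b c A n + countBelow A (k * c) = k * b := by
  induction n with
  | zero => exact ⟨0, le_rfl, by simp [depth, countBelow]⟩
  | succ n ih =>
    obtain ⟨k, hk, h⟩ := ih
    rcases le_total ((n + 1) * b - countBelow A ((n + 1) * c)) (depth b c A n) with hle | hle
    · exact ⟨k, hk.trans n.le_succ, by rw [depth, max_eq_left hle, h]⟩
    · rcases Nat.eq_zero_or_pos ((n + 1) * b - countBelow A ((n + 1) * c)) with h0 | h0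
      · exact ⟨k, hk.trans n.le_succ, by rw [depth, max_eq_left (by omega), h]⟩
      · exact ⟨n + 1, le_rfl, by rw [depth, max_eq_right hle]; omega⟩

theorem depth_congr {b c : ℕ} {A A' : Finset ℕ} {n : ℕ} (h : ∀ i < n * c, i ∈ A ↔ i ∈ A') :
    depth b c A n = depth b c A' n := by
  induction n with
  | zero => rfl
  | succ n ih =>
    have hle : n * c ≤ (n + 1) * c := Nat.mul_le_mul_right c n.le_succ
    have : A.filter (· < (n + 1) * c) = A'.filter (· < (n + 1) * c) := by
      ext i
      simp only [Finset.mem_filter]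
      exact and_congr_left fun hi => h i hi
    rw [depth, depth, ih fun i hi => h i (hi.trans_le hle), countBelow, countBelow, this]

/-- The enumerator of subsets of `[0, n * c)` by depth and by final height above the minimum. -/
def walkSum (b c n : ℕ) : MvPolynomial (Fin 2) ℚ :=
  ∑ A ∈ (Finset.range (n * c)).powerset,
    MvPolynomial.X 0 ^ depth b c A n * MvPolynomial.X 1 ^ (A.card + depth b c A n - n * b)

/-- The step enumerator: `z ^ (|B| - b)` summed over the subsets `B` of a set of size `c`. -/
def stepPoly (b c : ℕ) : ℚ[T;T⁻¹] := T (-b) * (1 + T 1) ^ c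

theorem countBelow_eq_card {A : Finset ℕ} {j : ℕ} (h : A ⊆ Finset.range j) :
    countBelow A j = A.card := by
  rw [countBelow, Finset.filter_true_of_mem fun i hi => Finset.mem_range.1 (h hi)]

/-- Let `q` be the height above the minimum and `B` the new block. The new height over the old
minimum is `h = q + |B| - b`: the minimum drops by the negative part of `h`, and the new height
above it is the positive part. This is the effect of `splitSign` on `z ^ h`. -/
theorem walkSum_succ (b c n : ℕ) :
    walkSum b c (n + 1) = walkStep (stepPoly b c) (walkSum b c n) := by
  have hle : n * c ≤ (n + 1) * c := Nat.mul_le_mul_right c n.le_succ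
  have hdisj : Disjoint (Finset.range (n * c)) (Finset.Ico (n * c) ((n + 1) * c)) :=
    Finset.disjoint_left.2 fun i hi hi' =>
      absurd (Finset.mem_Ico.1 hi').1 (not_le.2 (Finset.mem_range.1 hi))
  have hunion : Finset.range ((n + 1) * c) =
      Finset.range (n * c) ∪ Finset.Ico (n * c) ((n + 1) * c) := by
    ext i
    simp only [Finset.mem_union, Finset.mem_range, Finset.mem_Ico]
    omega
  rw [walkSum, walkSum, hunion, sum_powerset_union hdisj, map_sum]
  refine Finset.sum_congr rfl fun A hA => ?_
  rw [Finset.mem_powerset] at hA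
  -- The final height is at least the minimum, so the exponent `q` below is not truncated.
  have hinv := le_depth b c A (le_refl n)
  rw [countBelow_eq_card hA] at hinv
  obtain ⟨q, hq⟩ : ∃ q, q = A.card + depth b c A n - n * b := ⟨_, rfl⟩
  have hcard : (Finset.Ico (n * c) ((n + 1) * c)).card = c := by
    rw [Nat.card_Ico, Nat.succ_mul, Nat.add_sub_cancel_left]
  have hsum := sum_powerset_T (Finset.Ico (n * c) ((n + 1) * c)) ((q : ℤ) - b)
  rw [hcard] at hsum
  have hstep : stepPoly b c * T (q : ℤ) =
      ∑ B ∈ (Finset.Ico (n * c) ((n + 1) * c)).powerset, T ((B.card : ℤ) + ((q : ℤ) - b)) := by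
    rw [hsum, stepPoly, sub_eq_add_neg, T_add]
    ring
  rw [← hq, walkStep_X_pow_mul, hstep, map_sum, Finset.mul_sum]
  refine Finset.sum_congr rfl fun B hB => ?_
  rw [Finset.mem_powerset] at hB
  have hAB : Disjoint A B := (hdisj.mono_left hA).mono_right hB
  have hsub : A ∪ B ⊆ Finset.range ((n + 1) * c) := by
    rw [hunion]
    exact Finset.union_subset_union hA hB
  have hd : depth b c (A ∪ B) n = depth b c A n := depth_congr fun i hi => by
    rw [Finset.mem_union, or_iff_left]
    exact fun h => absurd (Finset.mem_Ico.1 (hB h)).1 (not_le.2 hi)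
  rw [depth, hd, countBelow_eq_card hsub, Finset.card_union_of_disjoint hAB, splitSign_T,
    ← mul_assoc, ← pow_add, Nat.succ_mul]
  congr 2 <;> omega

theorem walkSum_eq_partitionSum (b c n : ℕ) :
    walkSum b c n = partitionSum (fun m => splitSign (stepPoly b c ^ m)) n := by
  induction n with
  | zero => simp [walkSum, partitionSum_zero, depth]
  | succ n ih => rw [walkSum_succ, ih, walkStep_partitionSum]

/-- The substitution `x ↦ x - 1`, `y ↦ y - 1`. -/
def shift : MvPolynomial (Fin 2) ℚ →ₐ[ℚ] MvPolynomial (Fin 2) ℚ :=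
  MvPolynomial.aeval fun i => MvPolynomial.X i - 1

/-- With rank `min |A| (m b)`, corank and nullity are the negative and positive parts of `|A| - m
b`, and `∑ z ^ (|A| - m b)` factors into `m` equal steps. -/
theorem map_tutte_uniformAB (a b m : ℕ) :
    MvPolynomial.map (Int.castRingHom ℚ) (tutte (uniformAB a b m)) =
      shift (splitSign (stepPoly b (a + b) ^ m)) := by
  have hpow : stepPoly b (a + b) ^ m =
      ∑ A : Finset (Fin (m * (a + b))), T ((A.card : ℤ) + -(m * b : ℕ)) := by
    rw [← Finset.powerset_univ, sum_powerset_T, Finset.card_univ, Fintype.card_fin, stepPoly,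
      mul_pow, T_pow, ← pow_mul, mul_comm (a + b) m]
    push_cast
    rw [mul_neg]
  rw [tutte_of_ground_eq_univ _ rfl, hpow, map_sum, map_sum, map_sum]
  refine Finset.sum_congr rfl fun A _ => ?_
  have hle : m * b ≤ m * (a + b) := Nat.mul_le_mul_left m (Nat.le_add_left b a)
  have huniv := uniform_eRk hle Finset.univ
  rw [Finset.coe_univ, Finset.card_univ, Fintype.card_fin, min_eq_right hle] at huniv
  rw [uniformAB, huniv, uniform_eRk, splitSign_T]
  simp only [map_mul, map_pow, map_sub, map_one, MvPolynomial.map_X, shift, MvPolynomial.aeval_X]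
  congr 2 <;> omega

/-! ### The rank function of the Catalan matroid as the depth of a walk. -/

theorem count_mod (a b k r : ℕ) (hr : r ≤ a + b) :
    Nat.count (fun i => a ≤ i % (a + b)) (k * (a + b) + r) = k * b + (r - a) := by
  have inner : ∀ k r, r ≤ a + b → Nat.count (fun i => a ≤ i % (a + b)) (k * (a + b) + r) =
      Nat.count (fun i => a ≤ i % (a + b)) (k * (a + b)) + (r - a) := by
    intro k r
    induction r with
    | zero => simp
    | succ r ih =>
      intro hr
      rw [← add_assoc, Nat.count_succ, ih (by omega), Nat.mul_add_mod', Nat.mod_eq_of_lt hr]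
      split_ifs <;> omega
  have outer : ∀ k, Nat.count (fun i => a ≤ i % (a + b)) (k * (a + b)) = k * b := by
    intro k
    induction k with
    | zero => simp
    | succ k ih => rw [Nat.succ_mul, inner _ _ le_rfl, ih, Nat.succ_mul, Nat.add_sub_cancel_left]
  rw [inner k r hr, outer]

theorem countBelow_map_val {N : ℕ} (U : Finset (Fin N)) (j : ℕ) :
    countBelow (U.map Fin.valEmbedding) j = (U.filter fun i : Fin N => (i : ℕ) < j).card := by
  rw [countBelow, Finset.filter_map, Finset.card_map]
  rfl

theorem countBelow_mono (A : Finset ℕ) {i j : ℕ} (h : i ≤ j) : countBelow A i ≤ countBelow A j :=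
  Finset.card_le_card fun _ hx => Finset.mem_filter.2
    ⟨(Finset.mem_filter.1 hx).1, (Finset.mem_filter.1 hx).2.trans_le h⟩

theorem countBelow_add_le (A : Finset ℕ) (i k : ℕ) :
    countBelow A (i + k) ≤ countBelow A i + k := by
  have hsub : A.filter (· < i + k) ⊆ A.filter (· < i) ∪ Finset.Ico i (i + k) := by
    intro x hx
    simp only [Finset.mem_filter, Finset.mem_union, Finset.mem_Ico] at hx ⊢
    exact (lt_or_ge x i).imp (fun h => ⟨hx.1, h⟩) fun h => ⟨h, hx.2⟩
  have := (Finset.card_le_card hsub).trans (Finset.card_union_le _ _)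
  simpa [countBelow] using this

/-- The set defining the Catalan matroid, counted below `j`. -/
theorem card_catalanSet_filter_lt (a b n : ℕ) {j : ℕ} (hj : j ≤ n * (a + b)) :
    ((Finset.univ.filter fun i : Fin (n * (a + b)) => a ≤ (i : ℕ) % (a + b)).filter
      fun i : Fin (n * (a + b)) => (i : ℕ) < j).card =
      Nat.count (fun i => a ≤ i % (a + b)) j := by
  rw [Nat.count_eq_card_filter_range, ← countBelow_map_val, countBelow]
  congr 1
  ext i
  simp only [Finset.mem_filter, Finset.mem_map, Finset.mem_univ, true_and, Finset.mem_range,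
    Fin.valEmbedding_apply]
  constructor
  · rintro ⟨⟨x, hx, rfl⟩, h⟩
    exact ⟨h, hx⟩
  · rintro ⟨h, hi⟩
    exact ⟨⟨⟨i, h.trans_le hj⟩, hi, rfl⟩, h⟩

/-- The rank is the minimum over all cuts `j` of the bound in `schubert_eRk_le`, whereas `depth`
sees only cuts at block boundaries. The minimum is always attained at such a boundary. -/
theorem catalan_eRk_add_depth (a b n : ℕ) (A : Finset (Fin (n * (a + b)))) :
    ((catalan a b n).eRk (A : Set (Fin (n * (a + b))))).toNat +
      depth b (a + b) (A.map Fin.valEmbedding) n = n * b := by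
  obtain ⟨S, hS⟩ : ∃ S : Finset (Fin (n * (a + b))),
    S = Finset.univ.filter fun i : Fin (n * (a + b)) => a ≤ (i : ℕ) % (a + b) := ⟨_, rfl⟩
  have hcount : ∀ j ≤ n * (a + b), (S.filter fun i : Fin (n * (a + b)) => (i : ℕ) < j).card =
      Nat.count (fun i => a ≤ i % (a + b)) j := fun j hj => by
    rw [hS, card_catalanSet_filter_lt a b n hj]
  have hblock : ∀ k, Nat.count (fun i => a ≤ i % (a + b)) (k * (a + b)) = k * b := fun k => by
    simpa using count_mod a b k 0 (Nat.zero_le _)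
  have hcard : S.card = n * b := by
    rw [← hblock n, ← hcount _ le_rfl, Finset.filter_true_of_mem fun i _ => i.2]
  have hcatalan : catalan a b n = schubert S := by rw [hS, catalan]
  rw [hcatalan]
  refine le_antisymm ?_ ?_
  · obtain ⟨k, hk, h⟩ := exists_depth_eq b (a + b) (A.map Fin.valEmbedding) n
    have h1 := schubert_eRk_le S A (k * (a + b))
    have h2 := card_filter_lt_add S (k * (a + b))
    rw [hcount _ (Nat.mul_le_mul_right _ hk), hblock] at h2
    rw [countBelow_map_val] at h
    omega
  · obtain ⟨j, hj, h⟩ := exists_schubert_eRk_eq S A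
    have h2 := card_filter_lt_add S j
    rw [← countBelow_map_val] at h
    rw [hcount _ hj] at h2
    obtain ⟨k, hk, hle⟩ : ∃ k ≤ n, Nat.count (fun i => a ≤ i % (a + b)) j +
        countBelow (A.map Fin.valEmbedding) (k * (a + b)) ≤
        k * b + countBelow (A.map Fin.valEmbedding) j := by
      rcases hj.eq_or_lt with rfl | hj
      · exact ⟨n, le_rfl, by rw [hblock]⟩
      have hpos : 0 < a + b := by
        by_contra h0
        rw [Nat.eq_zero_of_not_pos h0] at hj
        simp at hj
      obtain ⟨k, r, hr, rfl⟩ : ∃ k r, r < a + b ∧ j = k * (a + b) + r :=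
        ⟨j / (a + b), j % (a + b), Nat.mod_lt _ hpos, (Nat.div_add_mod' j (a + b)).symm⟩
      have hk : k < n := by
        by_contra! hk
        have := Nat.mul_le_mul_right (a + b) hk
        omega
      rw [count_mod a b k r hr.le]
      -- In the `0^a` part of a block the count of `S` is constant, so moving the cut left to the
      -- block's start does no harm. In the `1^b` part it grows by one per position, at least as
      -- fast as that of `A`, so the cut moves right to the block's end.
      rcases le_total r a with hra | hra
      · refine ⟨k, hk.le, ?_⟩
        have := countBelow_mono (A.map Fin.valEmbedding) (Nat.le_add_right (k * (a + b)) r)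
        omega
      · refine ⟨k + 1, hk, ?_⟩
        have := countBelow_add_le (A.map Fin.valEmbedding) (k * (a + b) + r) (a + b - r)
        rw [show k * (a + b) + r + (a + b - r) = (k + 1) * (a + b) by rw [Nat.succ_mul]; omega]
          at this
        rw [Nat.succ_mul k b]
        omega
    have := le_depth b (a + b) (A.map Fin.valEmbedding) hk
    omega

theorem sum_powerset_range {M : Type*} [AddCommMonoid M] (N : ℕ) (g : Finset ℕ → M) :
    ∑ A ∈ (Finset.range N).powerset, g A =
      ∑ A : Finset (Fin N), g (A.map Fin.valEmbedding) := by
  symm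
  refine Finset.sum_nbij (fun A => A.map Fin.valEmbedding) ?_ ?_ ?_ (fun _ _ => rfl)
  · intro A _
    rw [Finset.mem_powerset]
    intro i hi
    obtain ⟨x, -, rfl⟩ := Finset.mem_map.1 hi
    exact Finset.mem_range.2 x.2
  · exact (Finset.map_injective _).injOn
  · intro A hA
    rw [Finset.mem_coe, Finset.mem_powerset] at hA
    refine ⟨Finset.univ.filter fun i : Fin N => (i : ℕ) ∈ A, by simp, ?_⟩
    ext i
    simp only [Finset.mem_map, Finset.mem_filter, Finset.mem_univ, true_and,
      Fin.valEmbedding_apply]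
    exact ⟨fun ⟨x, hx, h⟩ => h ▸ hx, fun hi => ⟨⟨i, Finset.mem_range.1 (hA hi)⟩, hi, rfl⟩⟩

theorem map_tutte_catalan (a b n : ℕ) :
    MvPolynomial.map (Int.castRingHom ℚ) (tutte (catalan a b n)) =
      shift (walkSum b (a + b) n) := by
  rw [tutte_of_ground_eq_univ _ rfl, walkSum, sum_powerset_range, map_sum, map_sum]
  refine Finset.sum_congr rfl fun A _ => ?_
  have hA := catalan_eRk_add_depth a b n A
  -- The walk of the full set never goes below 0, so its depth is 0.
  have huniv : ((catalan a b n).eRk Set.univ).toNat = n * b := by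
    have h := catalan_eRk_add_depth a b n Finset.univ
    obtain ⟨k, hk, hd⟩ := exists_depth_eq b (a + b)
      ((Finset.univ : Finset (Fin (n * (a + b)))).map Fin.valEmbedding) n
    have hcount : countBelow ((Finset.univ : Finset (Fin (n * (a + b)))).map Fin.valEmbedding)
        (k * (a + b)) = k * (a + b) := by
      have hle := Nat.mul_le_mul_right (a + b) hk
      rw [countBelow, Fin.map_valEmbedding_univ]
      have : (Finset.Iio (n * (a + b))).filter (· < k * (a + b)) = Finset.Iio (k * (a + b)) := by
        ext i
        simp only [Finset.mem_filter, Finset.mem_Iio]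
        omega
      rw [this, Nat.card_Iio]
    have hle : k * b ≤ k * (a + b) := Nat.mul_le_mul_left k (Nat.le_add_left b a)
    rw [Finset.coe_univ] at h
    omega
  rw [huniv, Finset.card_map]
  simp only [map_mul, map_pow, map_sub, map_one, MvPolynomial.map_X, shift, MvPolynomial.aeval_X]
  congr 2 <;> omega

theorem map_tutte_catalan_eq_partitionSum (a b n : ℕ) :
    MvPolynomial.map (Int.castRingHom ℚ) (tutte (catalan a b n)) =
      partitionSum
        (fun m => MvPolynomial.map (Int.castRingHom ℚ) (tutte (uniformAB a b m))) n := by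
  simp only [map_tutte_uniformAB]
  rw [map_tutte_catalan, walkSum_eq_partitionSum, map_partitionSum]

end Walk

end CatalanMatroid

end

theorem corollary4p3 (a b n : ℕ) (ha : 1 ≤ a) (hb : 1 ≤ b) :
    (∀ p : n.Partition,
      CatalanMatroid.tutte (CatalanMatroid.uniformSum a b p) =
        (p.parts.map fun k => CatalanMatroid.tutte (CatalanMatroid.uniformAB a b k)).prod) ∧
    MvPolynomial.map (Int.castRingHom ℚ) (CatalanMatroid.tutte (CatalanMatroid.catalan a b n)) =
      ∑ p : n.Partition, (1 / (CatalanMatroid.zee p : ℚ)) •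
        MvPolynomial.map (Int.castRingHom ℚ)
          (CatalanMatroid.tutte (CatalanMatroid.uniformSum a b p)) := by
  refine ⟨fun p => CatalanMatroid.tutte_uniformSum a b p, ?_⟩
  rw [CatalanMatroid.map_tutte_catalan_eq_partitionSum, CatalanMatroid.partitionSum]
  refine Finset.sum_congr rfl fun p _ => ?_
  rw [CatalanMatroid.tutte_uniformSum, map_multiset_prod, Multiset.map_map]
  rfl
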